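/- Sequence Datalog. Fix a countably infinite set $\mathbf{dom}$ of atomic values. Values and paths are defined by mutual recursion: atomic values are values, paths are finite sequences of values, and for every path $p$ the packed value $\langle p\rangle$ is a value. A schema is a finite set of relation names with arities; it is monadic if all arities are at most one. An instance of a schema assigns to each of its relation names a finite relation (of the right arity) on paths; it is flat if no packed values occur in it. Path expressions are built like paths, from atomic values, atomic variables $@x$ (ranging over $\mathbf{dom}$) and path variables $\$x$ (ranging over paths). A program is a finite sequence of strata, each a finite set of safe rules $H \leftarrow B$, where the head $H$ is a predicate $P(e_1,\dots,e_n)$ on path expressions and the body $B$ is a finite set of predicates, equations $e_1=e_2$ between path expressions, and negations of these; negation is stratified: if a negated predicate $\neg P(\dots)$ occurs in a stratum, no rule of that or a later stratum has $P$ in its head. A rule is safe if all its variables are limited, where the limited variables are the least set that contains the variables of the positive predicates in the body and that, if it contains all variables of one side of a positive equation in the body, contains those of the other side. Semantics is the usual stratum-by-stratum least (finite) model; if some stratum has no finite model, the program does not terminate on that input. IDB relation names are those used in heads; the other relation names of the program are EDB. A program is over a schema $\Gamma$ if its EDB names belong to $\Gamma$ and its IDB names do not. The features of programs are: $\mathsf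 A$ (a predicate of arity greater than one occurs), $\mathsf R$ (the dependency graph on IDB names has a cycle), $\mathsf E$ (an equation occurs, negated or not), $\mathsf N$ (a negated atom occurs), $\mathsf P$ (a packed expression $\langle e\rangle$ occurs), $\mathsf I$ (there are at least two different IDB names). Let $\Phi=\{\mathsf A,\mathsf E,\mathsf I,\mathsf N,\mathsf P,\mathsf R\}$. A program belongs to a fragment $F\subseteq\Phi$ if it uses only features from $F$. For a monadic schema $\Gamma$ and a relation name $S\notin\Gamma$ of arity at most one, a query from $\Gamma$ to $S$ is a total mapping $Q$ from flat instances of $\Gamma$ to flat instances of $\{S\}$; a program $\mathbf P$ computes $Q$ if it is over $\Gamma$, terminates on every flat instance of $\Gamma$, has $S$ as an IDB name, and satisfies $\mathbf P(I)(S)=Q(I)$ for every flat instance $I$ of $\Gamma$. Write $F_1\le F_2$ if every query computable by a program in $F_1$ is computable by a program in $F_2$. Theorem. $\mathsf I$ is primitive in the presence of $\mathsf N$, that is, $\{\mathsf I,\mathsf N\}\not\le\Phi\setminus\{\mathsf I\}$. Specifically, let $R$, $B$ and $S$ be unary, and let $Q$ be the query from $\{R,B\}$ to $S$ that, viewing the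 paths $x\cdot y$ in $R$ with $x,y\in\mathbf{dom}$ as the edges of a directed graph and the atomic values in $B$ as the black nodes, returns the nodes that have at least one outgoing edge and all of whose out-neighbours are black: $$Q(I)(S)=\{x\in\mathbf{dom} \mid \exists y\in\mathbf{dom}:\ x\cdot y\in I(R),\ \text{and}\ \forall y\in\mathbf{dom}:\ x\cdot y\in I(R)\Rightarrow y\in I(B)\}.$$ Then $Q$ is computable by a program in the fragment $\{\mathsf I,\mathsf N\}$, but by no program in the fragment $\Phi\setminus\{\mathsf I\}$. -/

import Mathlib

namespace SeqDatalog

/-! ### Data model -/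

/-- Values over a universe `D` of atomic values: an atomic value `a`, or a packed value `⟨p⟩`
where the path `p` is a finite sequence of values. -/
inductive Value (D : Type*) where
  | atom (a : D) : Value D
  | pack (p : List (Value D)) : Value D

/-- Paths are finite sequences of values; `[]` is the empty path, `++` is concatenation, and a
value `v` is identified with the one-element path `[v]`. -/
abbrev Path (D : Type*) := List (Value D)

/-- A path is flat if no packed value occurs in it. -/
def Path.IsFlat {D : Type*} (p : Path D) : Prop := ∀ v ∈ p, ∃ a : D, v = Value.atom a

/-- Relation names, each with its arity; there are infinitely many names of every arity. -/
structure RelName where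
  id : ℕ
  arity : ℕ
deriving DecidableEq

/-- A schema is a finite set of relation names. -/
abbrev Schema := Finset RelName

/-- A schema is monadic if its relation names have arity zero or one. -/
def Schema.IsMonadic (Γ : Schema) : Prop := ∀ R ∈ Γ, R.arity ≤ 1

/-- A fact `R(p₁, …, pₙ)`. -/
structure Fact (D : Type*) where
  rel : RelName
  args : Fin rel.arity → Path D

/-- A flat instance of the schema `Γ`, viewed as a finite set of facts. -/
structure FlatInstance (D : Type*) (Γ : Schema) where
  facts : Set (Fact D)
  finite : facts.Finite
  rel_mem : ∀ f ∈ facts, f.rel ∈ Γ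
  flat : ∀ f ∈ facts, ∀ i, Path.IsFlat (f.args i)

/-! ### Syntax -/

/-- Variables: atomic variables `@x` and path variables `$x`. -/
inductive Var where
  | atomic (x : ℕ) : Var
  | path (x : ℕ) : Var

/-- The elements of path expressions: atomic values, variables and packed path expressions. -/
inductive Item (D : Type*) where
  | const (a : D) : Item D
  | var (x : Var) : Item D
  | pack (e : List (Item D)) : Item D

/-- Path expressions are finite sequences of items. -/
abbrev PathExpr (D : Type*) := List (Item D)

mutual
/-- The variables occurring in an item. -/
def Item.vars {D : Type*} : Item D → Set Var
  | .const _ => ∅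
  | .var x => {x}
  | .pack e => PathExpr.vars e
/-- The variables occurring in a path expression. -/
def PathExpr.vars {D : Type*} : List (Item D) → Set Var
  | [] => ∅
  | t :: e => Item.vars t ∪ PathExpr.vars e
end

/-- Atoms: predicates `R(e₁, …, eₙ)` and equations `e₁ = e₂`. -/
inductive Atom (D : Type*) where
  | pred (R : RelName) (args : Fin R.arity → PathExpr D) : Atom D
  | eqn (e₁ e₂ : PathExpr D) : Atom D

/-- The path expressions that are the components of an atom. -/
def Atom.exprs {D : Type*} : Atom D → Set (PathExpr D)
  | .pred _ args => Set.range args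
  | .eqn e₁ e₂ => {e₁, e₂}

/-- Literals: atoms and negated atoms. -/
inductive Literal (D : Type*) where
  | pos (A : Atom D) : Literal D
  | neg (A : Atom D) : Literal D

/-- The atom underlying a literal. -/
def Literal.atom {D : Type*} : Literal D → Atom D
  | .pos A => A
  | .neg A => A

/-- A rule `H ← B`; the head `H` is the predicate `headRel(headArgs)` and the body `B` is a finite
set of literals. -/
structure Rule (D : Type*) where
  headRel : RelName
  headArgs : Fin headRel.arity → PathExpr D
  body : Finset (Literal D)

namespace Rule

variable {D : Type*}

/-- The atoms of a rule: its head and the atoms occurring, negated or not, in its body. -/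
def atoms (r : Rule D) : Set (Atom D) :=
  {A | A = .pred r.headRel r.headArgs ∨ ∃ L ∈ r.body, L.atom = A}

/-- The path expressions that are components of atoms of the rule. -/
def exprs (r : Rule D) : Set (PathExpr D) := {e | ∃ A ∈ r.atoms, e ∈ A.exprs}

/-- The variables occurring in a rule. -/
def vars (r : Rule D) : Set Var := {x | ∃ e ∈ r.exprs, x ∈ PathExpr.vars e}

/-- The limited variables of a rule. -/
inductive Limited (r : Rule D) : Var → Prop
  | pred {R : RelName} {args : Fin R.arity → PathExpr D} (i : Fin R.arity) {x : Var}
      (hL : Literal.pos (.pred R args) ∈ r.body) (hx : x ∈ PathExpr.vars (args i)) : Limited r x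
  | eqnRight {e₁ e₂ : PathExpr D} {x : Var} (hL : Literal.pos (.eqn e₁ e₂) ∈ r.body)
      (h : ∀ y ∈ PathExpr.vars e₁, Limited r y) (hx : x ∈ PathExpr.vars e₂) : Limited r x
  | eqnLeft {e₁ e₂ : PathExpr D} {x : Var} (hL : Literal.pos (.eqn e₁ e₂) ∈ r.body)
      (h : ∀ y ∈ PathExpr.vars e₂, Limited r y) (hx : x ∈ PathExpr.vars e₁) : Limited r x

/-- A rule is safe if all its variables are limited. -/
def IsSafe (r : Rule D) : Prop := ∀ x ∈ r.vars, r.Limited x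

end Rule

/-- A program is a finite sequence of strata, which are finite sets of safe rules, such that
negation is stratified: if `¬ R(…)` occurs in a stratum, then `R` is not used in the head of a
rule of that stratum or of a later one. -/
structure Program (D : Type*) where
  strata : List (Finset (Rule D))
  safe : ∀ σ ∈ strata, ∀ r ∈ σ, r.IsSafe
  stratified : ∀ i j : Fin strata.length, i ≤ j →
    ∀ r ∈ strata.get i, ∀ (R : RelName) (args : Fin R.arity → PathExpr D),
      Literal.neg (.pred R args) ∈ r.body → ∀ r' ∈ strata.get j, r'.headRel ≠ R

/-! ### Semantics -/

/-- A valuation maps atomic variables to atomic values and path variables to paths. -/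
structure Valuation (D : Type*) where
  atomic : ℕ → D
  path : ℕ → Path D

/-- The path assigned to a variable by a valuation. -/
def Valuation.onVar {D : Type*} (ν : Valuation D) : Var → Path D
  | .atomic x => [Value.atom (ν.atomic x)]
  | .path x => ν.path x

mutual
/-- Application of a valuation to an item. -/
def Item.eval {D : Type*} (ν : Valuation D) : Item D → List (Value D)
  | .const a => [Value.atom a]
  | .var x => ν.onVar x
  | .pack e => [Value.pack (PathExpr.eval ν e)]
/-- Application of a valuation to a path expression. -/
def PathExpr.eval {D : Type*} (ν : Valuation D) : List (Item D) → List (Value D)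
  | [] => []
  | t :: e => Item.eval ν t ++ PathExpr.eval ν e
end

/-- `I, ν` satisfies the atom. -/
def Atom.Holds {D : Type*} (I : Set (Fact D)) (ν : Valuation D) : Atom D → Prop
  | .pred R args => (⟨R, fun i => PathExpr.eval ν (args i)⟩ : Fact D) ∈ I
  | .eqn e₁ e₂ => PathExpr.eval ν e₁ = PathExpr.eval ν e₂

/-- `I, ν` satisfies the literal. -/
def Literal.Holds {D : Type*} (I : Set (Fact D)) (ν : Valuation D) : Literal D → Prop
  | .pos A => A.Holds I ν
  | .neg A => ¬ A.Holds I ν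

/-- The rule is satisfied in `I`. -/
def Rule.SatisfiedIn {D : Type*} (r : Rule D) (I : Set (Fact D)) : Prop :=
  ∀ ν : Valuation D, (∀ L ∈ r.body, L.Holds I ν) →
    (Atom.pred r.headRel r.headArgs).Holds I ν

/-- `K` is the result of applying the stratum `σ` to the instance `J`: the smallest (finite)
instance that contains `J`, agrees with `J` on the relation names that are not used in heads of
`σ`, and satisfies all rules of `σ`. -/
def IsStratumResult {D : Type*} (σ : Finset (Rule D)) (J K : Set (Fact D)) : Prop :=
  IsLeast {M : Set (Fact D) | M.Finite ∧ J ⊆ M ∧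
    (∀ f ∈ M, (∀ r ∈ σ, r.headRel ≠ f.rel) → f ∈ J) ∧ ∀ r ∈ σ, r.SatisfiedIn M} K

/-- `K` is the result of applying a sequence of strata, one after the other, to `J`. -/
def IsStrataResult {D : Type*} : List (Finset (Rule D)) → Set (Fact D) → Set (Fact D) → Prop
  | [], J, K => K = J
  | σ :: τ, J, K => ∃ M, IsStratumResult σ J M ∧ IsStrataResult τ M K

namespace Program

variable {D : Type*}

/-- The rules of a program. -/
def rules (P : Program D) : Set (Rule D) := {r | ∃ σ ∈ P.strata, r ∈ σ}

/-- The IDB relation names: those used in the head of some rule. -/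
def idb (P : Program D) : Set RelName := {R | ∃ r ∈ P.rules, r.headRel = R}

/-- The relation names occurring in a program. -/
def relNames (P : Program D) : Set RelName :=
  {R | ∃ r ∈ P.rules, ∃ args, Atom.pred R args ∈ r.atoms}

/-- The EDB relation names: those that occur in the program and are not IDB. -/
def edb (P : Program D) : Set RelName := P.relNames \ P.idb

/-- The program is over the schema `Γ`: its EDB relation names belong to `Γ` and its IDB relation
names do not. -/
def IsOver (P : Program D) (Γ : Schema) : Prop :=
  (∀ R ∈ P.edb, R ∈ Γ) ∧ ∀ R ∈ P.idb, R ∉ Γ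

/-- `K` is the result `P(J)`. -/
def IsResult (P : Program D) (J K : Set (Fact D)) : Prop := IsStrataResult P.strata J K

/-- The program terminates on `J`, i.e., `P(J)` is defined. -/
def TerminatesOn (P : Program D) (J : Set (Fact D)) : Prop := ∃ K, P.IsResult J K

/-- The edges of the dependency graph on the IDB relation names. -/
def DependsOn (P : Program D) (R₁ R₂ : RelName) : Prop :=
  R₁ ∈ P.idb ∧ R₂ ∈ P.idb ∧
    ∃ r ∈ P.rules, r.headRel = R₁ ∧ ∃ L ∈ r.body, ∃ args, L.atom = .pred R₂ args

end Program

/-! ### Features, fragments and queries -/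

/-- The six features: `A`, `R`, `E`, `N`, `P`, `I`. -/
inductive Feature where
  | arity
  | recursion
  | equations
  | negation
  | packing
  | intermediate

/-- The program uses the given feature. -/
def Program.Uses {D : Type*} (P : Program D) : Feature → Prop
  | .arity => ∃ R ∈ P.relNames, 1 < R.arity
  | .recursion => ∃ R, Relation.TransGen P.DependsOn R R
  | .equations => ∃ r ∈ P.rules, ∃ L ∈ r.body, ∃ e₁ e₂, L.atom = .eqn e₁ e₂
  | .negation => ∃ r ∈ P.rules, ∃ A, Literal.neg A ∈ r.body
  | .packing => ∃ r ∈ P.rules, ∃ e ∈ r.exprs, ∃ e', Item.pack e' ∈ e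
  | .intermediate => ∃ R₁ ∈ P.idb, ∃ R₂ ∈ P.idb, R₁ ≠ R₂

/-- A fragment is a set of features; `Set.univ` is the set of all features. -/
abbrev Fragment := Set Feature

/-- The program belongs to the fragment. -/
def Program.InFragment {D : Type*} (P : Program D) (F : Fragment) : Prop :=
  ∀ X, P.Uses X → X ∈ F

/-- Queries from `Γ` to `S`: total mappings from flat instances of `Γ` to flat instances
of `{S}`. -/
abbrev Query (D : Type*) (Γ : Schema) (S : RelName) := FlatInstance D Γ → FlatInstance D {S}

/-- The program computes the query. -/
def Program.Computes {D : Type*} (P : Program D) {Γ : Schema} {S : RelName}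
    (Q : Query D Γ S) : Prop :=
  P.IsOver Γ ∧
  (∀ I : FlatInstance D Γ, P.TerminatesOn I.facts) ∧
  S ∈ P.idb ∧
  ∀ (I : FlatInstance D Γ) (K : Set (Fact D)), P.IsResult I.facts K →
    {f ∈ K | f.rel = S} = (Q I).facts

/-- The query is computable by a program in the fragment `F`. -/
def Query.ComputableIn {D : Type*} {Γ : Schema} {S : RelName} (Q : Query D Γ S)
    (F : Fragment) : Prop :=
  ∃ P : Program D, P.InFragment F ∧ P.Computes Q

/-- Fragment `F₁` is subsumed by fragment `F₂` (for the universe `D` of atomic values). -/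
def Subsumed (D : Type*) (F₁ F₂ : Fragment) : Prop :=
  ∀ (Γ : Schema) (S : RelName), Γ.IsMonadic → S ∉ Γ → S.arity ≤ 1 →
    ∀ Q : Query D Γ S, Query.ComputableIn Q F₁ → Query.ComputableIn Q F₂

/-- Feature `X` is primitive in the presence of the set of features `Y`. -/
def PrimitiveInPresence (D : Type*) (X : Feature) (Y : Set Feature) : Prop :=
  ¬ Subsumed D ({X} ∪ Y) (Set.univ \ {X})

/-! ### The query -/

/-- The unary relation name `R`, whose paths `x·y` of length two are the edges of a graph. -/
def relR : RelName := ⟨0, 1⟩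

/-- The unary relation name `B`, whose atomic values are the black nodes. -/
def relB : RelName := ⟨1, 1⟩

/-- The unary output relation name `S`. -/
def relS : RelName := ⟨2, 1⟩

/-- The fact `R(x·y)`. -/
def edgeFact {D : Type*} (x y : D) : Fact D := ⟨relR, fun _ => [.atom x, .atom y]⟩

/-- The fact `B(y)`. -/
def blackFact {D : Type*} (y : D) : Fact D := ⟨relB, fun _ => [.atom y]⟩

/-- The fact `S(x)`. -/
def outFact {D : Type*} (x : D) : Fact D := ⟨relS, fun _ => [.atom x]⟩

/-- The query from `{R, B}` to `S` that returns the nodes with an outgoing edge, all of whose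
out-neighbours are black. -/
def allBlackQuery (D : Type*) : Query D {relR, relB} relS := fun I =>
  { facts := {f | ∃ x : D, f = outFact x ∧ (∃ y, edgeFact x y ∈ I.facts) ∧
      ∀ y, edgeFact x y ∈ I.facts → blackFact y ∈ I.facts}
    finite := by
      refine (I.finite.image (fun f : Fact D => (⟨relS, fun _ =>
        if h : 0 < f.rel.arity then (f.args ⟨0, h⟩).take 1 else []⟩ : Fact D))).subset ?_
      rintro f ⟨x, rfl, ⟨y, hy⟩, -⟩
      exact ⟨_, hy, by simp [edgeFact, outFact, relR]⟩
    rel_mem := by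
      rintro f ⟨x, rfl, -⟩
      simp [outFact]
    flat := by
      rintro f ⟨x, rfl, -⟩ i v hv
      exact ⟨x, by simpa [outFact] using hv⟩ }

end SeqDatalog

/-!
A program with a single IDB relation name cannot negate that name, by stratification, so every
negated predicate refers to the input, which never changes. If the output is nonempty, then some
rule already fires on the input itself, and the positive predicates of its body match boundedly
many input facts. Deleting any other input facts keeps the rule firing, so the output stays
nonempty. The query lacks this property: on a star with all leaves black its output is the centre,
but removing the colour of any single leaf makes the output empty. With an intermediate relation
name `T` the query is computed by `T(@x) ← R(@x·@y), ¬ B(@y)` followed by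
`S(@x) ← R(@x·@y), ¬ T(@x)`.
-/

namespace SeqDatalog

variable {D : Type*}

/-! ### Firing of rules -/

/-- The fact that the head of the rule becomes under the valuation. -/
def Rule.headFact (r : Rule D) (ν : Valuation D) : Fact D :=
  ⟨r.headRel, fun i => PathExpr.eval ν (r.headArgs i)⟩

/-- The body of the rule holds in `J` under `ν`. -/
def Rule.FiresOn (r : Rule D) (J : Set (Fact D)) (ν : Valuation D) : Prop :=
  ∀ L ∈ r.body, L.Holds J ν

/-- The fact that a positive predicate requires under the valuation; `none` for equations and
negated atoms, which require no fact. -/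
def Literal.premise (ν : Valuation D) : Literal D → Option (Fact D)
  | .pos (.pred R args) => some ⟨R, fun i => PathExpr.eval ν (args i)⟩
  | _ => none

/-- The facts required by the positive predicates in the body of the rule under the valuation. -/
def Rule.premises (r : Rule D) (ν : Valuation D) : Set (Fact D) :=
  {f | ∃ L ∈ r.body, L.premise ν = some f}

theorem Rule.mem_premises {r : Rule D} {ν : Valuation D} {f : Fact D} :
    f ∈ r.premises ν ↔ ∃ (R : RelName) (args : Fin R.arity → PathExpr D),
      Literal.pos (.pred R args) ∈ r.body ∧ ⟨R, fun i => PathExpr.eval ν (args i)⟩ = f := by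
  constructor
  · rintro ⟨(⟨R, args⟩ | _) | _, hL, hf⟩
    · exact ⟨R, args, hL, Option.some.inj hf⟩
    all_goals cases hf
  · rintro ⟨R, args, hL, rfl⟩
    exact ⟨_, hL, rfl⟩

theorem Rule.encard_premises_le (r : Rule D) (ν : Valuation D) :
    (r.premises ν).encard ≤ r.body.card := by
  calc (r.premises ν).encard
      = (some '' r.premises ν).encard := ((Option.some_injective _).encard_image _).symm
    _ ≤ (Literal.premise ν '' (r.body : Set (Literal D))).encard := by
        refine Set.encard_le_encard ?_
        rintro _ ⟨f, ⟨L, hL, hf⟩, rfl⟩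
        exact ⟨L, hL, hf⟩
    _ ≤ (r.body : Set (Literal D)).encard := Set.encard_image_le _ _
    _ = r.body.card := Set.encard_coe_eq_coe_finsetCard _

theorem Rule.FiresOn.premises_subset {r : Rule D} {J : Set (Fact D)} {ν : Valuation D}
    (h : r.FiresOn J ν) : r.premises ν ⊆ J := by
  intro f hf
  obtain ⟨R, args, hL, rfl⟩ := Rule.mem_premises.1 hf
  exact h _ hL

theorem Rule.FiresOn.of_premises_subset {r : Rule D} {J M : Set (Fact D)} {ν : Valuation D}
    (h : r.FiresOn J ν) (hpos : r.premises ν ⊆ M)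
    (hneg : ∀ R args, Literal.neg (.pred R args) ∈ r.body → ∀ f ∈ M, f.rel = R → f ∈ J) :
    r.FiresOn M ν := by
  rintro ((⟨R, args⟩ | ⟨e₁, e₂⟩) | (⟨R, args⟩ | ⟨e₁, e₂⟩)) hL
  · exact hpos (Rule.mem_premises.2 ⟨R, args, hL, rfl⟩)
  · exact h _ hL
  · exact fun hM => h _ hL (hneg R args hL _ hM rfl)
  · exact h _ hL

/-! ### Results of strata and programs -/

theorem IsStrataResult.unique {τ : List (Finset (Rule D))} {J K K' : Set (Fact D)}
    (h : IsStrataResult τ J K) (h' : IsStrataResult τ J K') : K = K' := by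
  induction τ generalizing J with
  | nil => exact Eq.trans h (Eq.symm h')
  | cons σ τ ih =>
    obtain ⟨M, hM, h⟩ := h
    obtain ⟨M', hM', h'⟩ := h'
    obtain rfl := IsLeast.unique hM hM'
    exact ih h h'

theorem IsStrataResult.subset {τ : List (Finset (Rule D))} {J K : Set (Fact D)}
    (h : IsStrataResult τ J K) : J ⊆ K := by
  induction τ generalizing J with
  | nil => exact (Eq.symm h).subset
  | cons σ τ ih =>
    obtain ⟨M, hM, h⟩ := h
    exact hM.1.2.1.trans (ih h)

theorem isStrataResult_self {τ : List (Finset (Rule D))} {J : Set (Fact D)} (hJ : J.Finite)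
    (h : ∀ σ ∈ τ, ∀ r ∈ σ, r.SatisfiedIn J) : IsStrataResult τ J J := by
  induction τ with
  | nil => rfl
  | cons σ τ ih =>
    have hσ : IsStratumResult σ J J :=
      ⟨⟨hJ, subset_rfl, fun _ hf _ => hf, h σ List.mem_cons_self⟩, fun _ hM => hM.2.1⟩
    exact ⟨J, hσ, ih fun ρ hρ => h ρ (List.mem_cons_of_mem _ hρ)⟩

theorem IsStrataResult.headFact_mem {τ : List (Finset (Rule D))} {J K : Set (Fact D)}
    (h : IsStrataResult τ J K) {σ : Finset (Rule D)} (hσ : σ ∈ τ) {r : Rule D} (hr : r ∈ σ)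
    (hneg : ∀ R args, Literal.neg (.pred R args) ∈ r.body → ∀ σ' ∈ τ, ∀ r' ∈ σ', r'.headRel ≠ R)
    {ν : Valuation D} (hν : r.FiresOn J ν) : r.headFact ν ∈ K := by
  induction τ generalizing J with
  | nil => exact absurd hσ List.not_mem_nil
  | cons σ₀ τ ih =>
    obtain ⟨M, ⟨⟨-, hJM, hM, hsat⟩, -⟩, h⟩ := h
    have hνM : r.FiresOn M ν := by
      refine hν.of_premises_subset (hν.premises_subset.trans hJM) ?_
      rintro _ args hL f hf rfl
      exact hM f hf (hneg _ args hL σ₀ List.mem_cons_self)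
    rcases List.mem_cons.1 hσ with rfl | hσ
    · exact h.subset (hsat r hr ν hνM)
    · exact ih h hσ (fun R args hL σ' hσ' => hneg R args hL σ' (List.mem_cons_of_mem _ hσ')) hνM

/-- The facts derived from `J` by applying the rules of the stratum once. -/
def immediateConsequences (σ : Finset (Rule D)) (J : Set (Fact D)) : Set (Fact D) :=
  {f | ∃ r ∈ σ, ∃ ν, r.FiresOn J ν ∧ r.headFact ν = f}

theorem mem_union_immediateConsequences_iff {σ : Finset (Rule D)} {J : Set (Fact D)} {f : Fact D}
    (hf : ∀ r ∈ σ, r.headRel ≠ f.rel) : f ∈ J ∪ immediateConsequences σ J ↔ f ∈ J := by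
  refine or_iff_left ?_
  rintro ⟨r, hr, ν, -, rfl⟩
  exact hf r hr rfl

/-- No relation name used in a head of the stratum occurs in a body of the stratum. -/
def IsNonrecursive (σ : Finset (Rule D)) : Prop :=
  ∀ r ∈ σ, ∀ L ∈ r.body, ∀ R args, L.atom = .pred R args → ∀ r' ∈ σ, r'.headRel ≠ R

theorem IsNonrecursive.firesOn_iff {σ : Finset (Rule D)} (hσ : IsNonrecursive σ) {r : Rule D}
    (hr : r ∈ σ) {J M : Set (Fact D)} (hJM : J ⊆ M)
    (hM : ∀ f ∈ M, (∀ r' ∈ σ, r'.headRel ≠ f.rel) → f ∈ J) {ν : Valuation D} :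
    r.FiresOn M ν ↔ r.FiresOn J ν := by
  constructor <;> intro h
  · refine h.of_premises_subset (fun f hf => hM f (h.premises_subset hf) ?_)
      fun _ _ _ f hf _ => hJM hf
    obtain ⟨R, args, hL, rfl⟩ := Rule.mem_premises.1 hf
    exact hσ r hr _ hL R args rfl
  · refine h.of_premises_subset (h.premises_subset.trans hJM) ?_
    rintro _ args hL f hf rfl
    exact hM f hf (hσ r hr _ hL _ args rfl)

theorem IsNonrecursive.isStratumResult {σ : Finset (Rule D)} (hσ : IsNonrecursive σ)
    {J : Set (Fact D)} (hJ : J.Finite) (hσJ : (immediateConsequences σ J).Finite) :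
    IsStratumResult σ J (J ∪ immediateConsequences σ J) := by
  have hframe : ∀ f ∈ J ∪ immediateConsequences σ J, (∀ r ∈ σ, r.headRel ≠ f.rel) → f ∈ J :=
    fun f hf hne => (mem_union_immediateConsequences_iff hne).1 hf
  refine ⟨⟨hJ.union hσJ, Set.subset_union_left, hframe, fun r hr ν hν => ?_⟩, ?_⟩
  · exact Or.inr ⟨r, hr, ν, (hσ.firesOn_iff hr Set.subset_union_left hframe).1 hν, rfl⟩
  · rintro M ⟨-, hJM, hM, hsat⟩ f (hf | ⟨r, hr, ν, hν, rfl⟩)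
    · exact hJM hf
    · exact hsat r hr ν ((hσ.firesOn_iff hr hJM hM).2 hν)

/-! ### Programs without intermediate relation names -/

namespace Program

variable {P : Program D}

theorem finite_rules (P : Program D) : P.rules.Finite :=
  (P.strata.finite_toSet.biUnion fun σ _ => σ.finite_toSet).subset
    fun _ ⟨_, hσ, hr⟩ => Set.mem_biUnion hσ hr

theorem headRel_eq_of_mem_idb (hP : ¬ P.Uses .intermediate) {r : Rule D} (hr : r ∈ P.rules)
    {S : RelName} (hS : S ∈ P.idb) : r.headRel = S := by
  by_contra hne
  exact hP ⟨_, ⟨r, hr, rfl⟩, S, hS, hne⟩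

theorem headRel_ne_of_neg_mem (hP : ¬ P.Uses .intermediate) {r r' : Rule D} (hr : r ∈ P.rules)
    (hr' : r' ∈ P.rules) {R : RelName} {args : Fin R.arity → PathExpr D}
    (hL : Literal.neg (.pred R args) ∈ r.body) : r'.headRel ≠ R := by
  rw [headRel_eq_of_mem_idb hP hr' ⟨r, hr, rfl⟩]
  obtain ⟨σ, hσ, hrσ⟩ := hr
  obtain ⟨i, rfl⟩ := List.get_of_mem hσ
  exact P.stratified i i le_rfl r hrσ R args hL r hrσ

theorem IsResult.headFact_mem (hP : ¬ P.Uses .intermediate) {J K : Set (Fact D)}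
    (hK : P.IsResult J K) {r : Rule D} (hr : r ∈ P.rules) {ν : Valuation D}
    (hν : r.FiresOn J ν) : r.headFact ν ∈ K := by
  have ⟨σ, hσ, hrσ⟩ := hr
  exact IsStrataResult.headFact_mem hK hσ hrσ
    (fun _ _ hL σ' hσ' _ hr' => headRel_ne_of_neg_mem hP hr ⟨σ', hσ', hr'⟩ hL) hν

variable {Γ : Schema} {S : RelName} {Q : Query D Γ S}

theorem Computes.exists_firesOn (hPQ : P.Computes Q) {I : FlatInstance D Γ}
    (hI : (Q I).facts.Nonempty) : ∃ r ∈ P.rules, ∃ ν, r.FiresOn I.facts ν := by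
  obtain ⟨⟨-, hidb⟩, -, hS, hres⟩ := hPQ
  by_contra! hcon
  have hself : P.IsResult I.facts I.facts :=
    isStrataResult_self I.finite fun σ hσ r hr ν hν => absurd hν (hcon r ⟨σ, hσ, hr⟩ ν)
  obtain ⟨f, hf⟩ := hI
  rw [← hres I _ hself] at hf
  obtain ⟨hfI, rfl⟩ := hf
  exact hidb _ hS (I.rel_mem f hfI)

theorem Computes.nonempty_of_firesOn (hPQ : P.Computes Q) (hP : ¬ P.Uses .intermediate)
    {I : FlatInstance D Γ} {r : Rule D} (hr : r ∈ P.rules) {ν : Valuation D}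
    (hν : r.FiresOn I.facts ν) : (Q I).facts.Nonempty := by
  obtain ⟨-, hterm, hS, hres⟩ := hPQ
  obtain ⟨K, hK⟩ := hterm I
  refine ⟨r.headFact ν, ?_⟩
  rw [← hres I K hK]
  exact ⟨hK.headFact_mem hP hr hν, headRel_eq_of_mem_idb hP hr hS⟩

end Program

/-- Nonemptiness of `Q` is witnessed by boundedly many facts: for some `m`, whenever `Q I` is
nonempty, there are at most `m` facts of `I` such that `Q` stays nonempty on all subinstances
of `I` that contain them. -/
def Query.HasBoundedWitnesses {Γ : Schema} {S : RelName} (Q : Query D Γ S) : Prop :=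
  ∃ m : ℕ, ∀ I : FlatInstance D Γ, (Q I).facts.Nonempty →
    ∃ W ⊆ I.facts, W.encard ≤ m ∧
      ∀ J : FlatInstance D Γ, W ⊆ J.facts → J.facts ⊆ I.facts → (Q J).facts.Nonempty

theorem Program.Computes.hasBoundedWitnesses {P : Program D} {Γ : Schema} {S : RelName}
    {Q : Query D Γ S} (hPQ : P.Computes Q) (hP : ¬ P.Uses .intermediate) :
    Query.HasBoundedWitnesses Q := by
  obtain ⟨m, hm⟩ := (P.finite_rules.image fun r => r.body.card).bddAbove
  refine ⟨m, fun I hI => ?_⟩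
  obtain ⟨r, hr, ν, hν⟩ := hPQ.exists_firesOn hI
  have hcard : r.body.card ≤ m := hm ⟨r, hr, rfl⟩
  refine ⟨r.premises ν, hν.premises_subset,
    (r.encard_premises_le ν).trans (Nat.cast_le.2 hcard), fun J hWJ hJI => ?_⟩
  exact hPQ.nonempty_of_firesOn hP hr
    (hν.of_premises_subset hWJ fun _ _ _ f hf _ => hJI hf)

theorem Query.ComputableIn.hasBoundedWitnesses {Γ : Schema} {S : RelName} {Q : Query D Γ S}
    (hQ : Query.ComputableIn Q (Set.univ \ {.intermediate})) : Query.HasBoundedWitnesses Q := by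
  obtain ⟨P, hfrag, hPQ⟩ := hQ
  exact hPQ.hasBoundedWitnesses fun h => (hfrag _ h).2 rfl

theorem primitiveInPresence_of_computableIn {X : Feature} {Y : Set Feature} {Γ : Schema}
    {S : RelName} (hΓ : Γ.IsMonadic) (hSΓ : S ∉ Γ) (hS : S.arity ≤ 1) {Q : Query D Γ S}
    (hQ : Query.ComputableIn Q ({X} ∪ Y)) (hQ' : ¬ Query.ComputableIn Q (Set.univ \ {X})) :
    PrimitiveInPresence D X Y :=
  fun hsub => hQ' (hsub Γ S hΓ hSΓ hS Q hQ)

/-! ### Star graphs -/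

theorem Fact.mk_const_inj {R : RelName} (hR : 0 < R.arity) {p q : Path D} :
    (⟨R, fun _ => p⟩ : Fact D) = ⟨R, fun _ => q⟩ ↔ p = q := by
  have : Nonempty (Fin R.arity) := ⟨⟨0, hR⟩⟩
  simp [funext_iff]

theorem edgeFact_inj {x y x' y' : D} : edgeFact x y = edgeFact x' y' ↔ x = x' ∧ y = y' :=
  (Fact.mk_const_inj Nat.one_pos).trans (by simp)

theorem blackFact_inj {y y' : D} : blackFact y = blackFact y' ↔ y = y' :=
  (Fact.mk_const_inj Nat.one_pos).trans (by simp)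

theorem edgeFact_ne_blackFact (x y z : D) : edgeFact x y ≠ blackFact z :=
  fun h => absurd (congrArg Fact.rel h) (by change relR ≠ relB; decide)

/-- The star with centre `a` and set of leaves `V`, in which `W` is the set of black nodes. -/
def starInstance (a : D) (V W : Finset D) : FlatInstance D {relR, relB} where
  facts := edgeFact a '' V ∪ blackFact '' W
  finite := (V.finite_toSet.image _).union (W.finite_toSet.image _)
  rel_mem := by
    rintro _ (⟨y, -, rfl⟩ | ⟨y, -, rfl⟩) <;> simp [edgeFact, blackFact]
  flat := by
    rintro _ (⟨y, -, rfl⟩ | ⟨y, -, rfl⟩) _ <;> simp [edgeFact, blackFact, Path.IsFlat]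

theorem edgeFact_mem_starInstance {a x y : D} {V W : Finset D} :
    edgeFact x y ∈ (starInstance a V W).facts ↔ x = a ∧ y ∈ V := by
  constructor
  · rintro (⟨z, hz, h⟩ | ⟨z, -, h⟩)
    · obtain ⟨rfl, rfl⟩ := edgeFact_inj.1 h
      exact ⟨rfl, hz⟩
    · exact absurd h.symm (edgeFact_ne_blackFact x y z)
  · rintro ⟨rfl, hy⟩
    exact Or.inl ⟨y, hy, rfl⟩

theorem blackFact_mem_starInstance {a y : D} {V W : Finset D} :
    blackFact y ∈ (starInstance a V W).facts ↔ y ∈ W := by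
  constructor
  · rintro (⟨z, -, h⟩ | ⟨z, hz, h⟩)
    · exact absurd h (edgeFact_ne_blackFact a z y)
    · obtain rfl := blackFact_inj.1 h
      exact hz
  · exact fun hy => Or.inr ⟨y, hy, rfl⟩

theorem nonempty_allBlackQuery_starInstance_iff {a : D} {V W : Finset D} :
    (allBlackQuery D (starInstance a V W)).facts.Nonempty ↔ V.Nonempty ∧ V ⊆ W := by
  constructor
  · rintro ⟨_, x, -, ⟨y, hy⟩, hall⟩
    obtain ⟨rfl, hyV⟩ := edgeFact_mem_starInstance.1 hy
    exact ⟨⟨y, hyV⟩, fun z hz =>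
      blackFact_mem_starInstance.1 (hall z (edgeFact_mem_starInstance.2 ⟨rfl, hz⟩))⟩
  · rintro ⟨⟨y, hy⟩, hVW⟩
    exact ⟨outFact a, a, rfl, ⟨y, edgeFact_mem_starInstance.2 ⟨rfl, hy⟩⟩, fun z hz =>
      blackFact_mem_starInstance.2 (hVW (edgeFact_mem_starInstance.1 hz).2)⟩

theorem exists_blackFact_notMem_of_encard_lt {W : Set (Fact D)} {V : Finset D}
    (h : W.encard < V.card) : ∃ b ∈ V, blackFact b ∉ W := by
  by_contra! hcon
  refine h.not_ge ?_
  calc (V.card : ℕ∞)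
      = (blackFact '' (V : Set D)).encard := by
        rw [Function.Injective.encard_image fun _ _ => blackFact_inj.1,
          Set.encard_coe_eq_coe_finsetCard]
    _ ≤ W.encard := Set.encard_le_encard (Set.image_subset_iff.2 hcon)

theorem not_hasBoundedWitnesses_allBlackQuery [Infinite D] :
    ¬ Query.HasBoundedWitnesses (allBlackQuery D) := by
  classical
  rintro ⟨m, hm⟩
  obtain ⟨a⟩ : Nonempty D := inferInstance
  obtain ⟨V, hV⟩ := Infinite.exists_subset_card_eq D (m + 1)
  have hVne : V.Nonempty := Finset.card_pos.1 (by omega)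
  obtain ⟨W, hWV, hWm, hW⟩ := hm (starInstance a V V)
    (nonempty_allBlackQuery_starInstance_iff.2 ⟨hVne, subset_rfl⟩)
  obtain ⟨b, hbV, hbW⟩ : ∃ b ∈ V, blackFact b ∉ W :=
    exists_blackFact_notMem_of_encard_lt (hWm.trans_lt (by rw [hV]; exact_mod_cast m.lt_succ_self))
  have hWb : W ⊆ (starInstance a V (V.erase b)).facts := by
    intro f hf
    rcases hWV hf with hedge | ⟨y, hy, rfl⟩
    · exact Or.inl hedge
    · have hyb : y ≠ b := by
        rintro rfl
        exact hbW hf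
      exact blackFact_mem_starInstance.2 (Finset.mem_erase.2 ⟨hyb, hy⟩)
  have hbV' : (starInstance a V (V.erase b)).facts ⊆ (starInstance a V V).facts :=
    Set.union_subset_union_right _ (Set.image_mono (Finset.coe_subset.2 (V.erase_subset b)))
  have hsub := (nonempty_allBlackQuery_starInstance_iff.1 (hW _ hWb hbV')).2
  exact V.notMem_erase b (hsub hbV)

theorem not_computableIn_allBlackQuery [Infinite D] :
    ¬ Query.ComputableIn (allBlackQuery D) (Set.univ \ {.intermediate}) :=
  fun h => not_hasBoundedWitnesses_allBlackQuery h.hasBoundedWitnesses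

/-! ### A program with an intermediate relation name -/

theorem PathExpr.exists_mem_of_mem_vars {e : PathExpr D} {x : Var} (hx : x ∈ PathExpr.vars e) :
    ∃ t ∈ e, x ∈ Item.vars t := by
  induction e with
  | nil => exact absurd hx (by simp [PathExpr.vars])
  | cons t e ih =>
    rw [PathExpr.vars] at hx
    rcases hx with hx | hx
    · exact ⟨t, List.mem_cons_self, hx⟩
    · obtain ⟨t', ht', hx'⟩ := ih hx
      exact ⟨t', List.mem_cons_of_mem _ ht', hx'⟩

/-- The atom `R(e)` for unary `R`; for other arities the argument `e` is repeated. -/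
def unaryAtom (R : RelName) (e : PathExpr D) : Atom D := .pred R fun _ => e

/-- The fact `R(x)` for unary `R`; for other arities the argument `x` is repeated. -/
def nodeFact (R : RelName) (x : D) : Fact D := ⟨R, fun _ => [.atom x]⟩

theorem nodeFact_inj {R : RelName} (hR : 0 < R.arity) {x y : D} :
    nodeFact R x = nodeFact R y ↔ x = y :=
  (Fact.mk_const_inj hR).trans (by simp)

/-- The atomic variable `@n`, as an item of path expressions. -/
def atomicVar (D : Type*) (n : ℕ) : Item D := .var (.atomic n)

open Classical in
/-- The rule `H(@0) ← R(@0·@1), ¬ N(@i)`, whose variables `@0` and `@1` stand for the source and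
the target of an edge. -/
noncomputable def edgeRule (D : Type*) (H N : RelName) (i : Fin 2) : Rule D where
  headRel := H
  headArgs := fun _ => [atomicVar D 0]
  body := {.pos (unaryAtom relR [atomicVar D 0, atomicVar D 1]),
    .neg (unaryAtom N [atomicVar D i])}

section EdgeRule

variable {H N : RelName} {i : Fin 2}

theorem mem_body_edgeRule {L : Literal D} : L ∈ (edgeRule D H N i).body ↔
    L = .pos (unaryAtom relR [atomicVar D 0, atomicVar D 1]) ∨
      L = .neg (unaryAtom N [atomicVar D i]) := by
  simp [edgeRule]

theorem eq_of_neg_mem_body_edgeRule {R : RelName} {args : Fin R.arity → PathExpr D}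
    (hL : Literal.neg (.pred R args) ∈ (edgeRule D H N i).body) : R = N := by
  rcases mem_body_edgeRule.1 hL with h | h <;> cases h
  rfl

theorem mem_atoms_edgeRule {A : Atom D} : A ∈ (edgeRule D H N i).atoms ↔
    A = unaryAtom H [atomicVar D 0] ∨ A = unaryAtom relR [atomicVar D 0, atomicVar D 1] ∨
      A = unaryAtom N [atomicVar D i] := by
  simp only [Rule.atoms, Set.mem_ofPred_eq, mem_body_edgeRule, exists_eq_or_imp, exists_eq_left,
    Literal.atom, eq_comm (a := A)]
  rfl

theorem eq_atomicVar_of_mem_exprs_edgeRule {e : PathExpr D} (he : e ∈ (edgeRule D H N i).exprs)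
    {t : Item D} (ht : t ∈ e) : ∃ j : Fin 2, t = atomicVar D j := by
  obtain ⟨A, hA, he⟩ := he
  rcases mem_atoms_edgeRule.1 hA with rfl | rfl | rfl <;> obtain ⟨_, rfl⟩ := he
  · exact ⟨0, List.mem_singleton.1 ht⟩
  · rcases List.mem_pair.1 ht with rfl | rfl
    exacts [⟨0, rfl⟩, ⟨1, rfl⟩]
  · exact ⟨i, List.mem_singleton.1 ht⟩

theorem isSafe_edgeRule : (edgeRule D H N i).IsSafe := by
  rintro x ⟨e, he, hx⟩
  obtain ⟨t, ht, hxt⟩ := PathExpr.exists_mem_of_mem_vars hx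
  obtain ⟨j, rfl⟩ := eq_atomicVar_of_mem_exprs_edgeRule he ht
  obtain rfl : x = .atomic j := hxt
  refine .pred (⟨0, Nat.one_pos⟩ : Fin relR.arity) (mem_body_edgeRule.2 (Or.inl rfl)) ?_
  fin_cases j <;> simp [PathExpr.vars, Item.vars, atomicVar]

theorem isNonrecursive_edgeRule (hR : H ≠ relR) (hN : H ≠ N) :
    IsNonrecursive {edgeRule D H N i} := by
  intro r hr L hL R args hA r' hr'
  obtain rfl := Finset.mem_singleton.1 hr
  obtain rfl := Finset.mem_singleton.1 hr'
  rcases mem_body_edgeRule.1 hL with rfl | rfl <;> cases hA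
  exacts [hR, hN]

theorem mem_immediateConsequences_edgeRule {J : Set (Fact D)} {f : Fact D} :
    f ∈ immediateConsequences {edgeRule D H N i} J ↔
      ∃ x y, edgeFact x y ∈ J ∧ nodeFact N (![x, y] i) ∉ J ∧ nodeFact H x = f := by
  constructor
  · rintro ⟨r, hr, ν, hν, rfl⟩
    obtain rfl := Finset.mem_singleton.1 hr
    have hN := hν _ (mem_body_edgeRule.2 (Or.inr rfl))
    refine ⟨ν.atomic 0, ν.atomic 1, hν _ (mem_body_edgeRule.2 (Or.inl rfl)), ?_, rfl⟩
    fin_cases i <;> exact hN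
  · rintro ⟨x, y, hR, hN, rfl⟩
    refine ⟨_, Finset.mem_singleton_self _, ⟨fun n => if n = 0 then x else y, fun _ => []⟩,
      fun L hL => ?_, rfl⟩
    rcases mem_body_edgeRule.1 hL with rfl | rfl
    · exact hR
    · fin_cases i <;> exact hN

theorem finite_immediateConsequences_edgeRule {J : Set (Fact D)} (hJ : J.Finite) :
    (immediateConsequences {edgeRule D H N i} J).Finite := by
  have hedges : {p : D × D | edgeFact p.1 p.2 ∈ J}.Finite :=
    hJ.preimage fun _ _ _ _ h => Prod.ext_iff.2 (edgeFact_inj.1 h)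
  refine (hedges.image fun p => nodeFact H p.1).subset fun f hf => ?_
  obtain ⟨x, y, hR, -, rfl⟩ := mem_immediateConsequences_edgeRule.1 hf
  exact ⟨(x, y), hR, rfl⟩

end EdgeRule

/-- The intermediate relation name `T`, for the nodes with an out-neighbour that is not black. -/
def relT : RelName := ⟨3, 1⟩

/-- The program `T(@0) ← R(@0·@1), ¬ B(@1)`; `S(@0) ← R(@0·@1), ¬ T(@0)`, with one rule in each of
its two strata. -/
noncomputable def allBlackProgram (D : Type*) : Program D where
  strata := [{edgeRule D relT relB 1}, {edgeRule D relS relT 0}]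
  safe := by
    simp [isSafe_edgeRule]
  stratified := by
    intro i j hij r hr R args hL r' hr'
    fin_cases i <;> fin_cases j <;>
      obtain rfl := Finset.mem_singleton.1 hr <;> obtain rfl := Finset.mem_singleton.1 hr' <;>
      obtain rfl := eq_of_neg_mem_body_edgeRule hL
    · change relT ≠ relB
      decide
    · change relS ≠ relB
      decide
    · exact absurd hij (Nat.not_succ_le_zero 0)
    · change relS ≠ relT
      decide

theorem mem_rules_allBlackProgram {r : Rule D} : r ∈ (allBlackProgram D).rules ↔
    r = edgeRule D relT relB 1 ∨ r = edgeRule D relS relT 0 := by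
  simp [Program.rules, allBlackProgram]

theorem idb_allBlackProgram : (allBlackProgram D).idb = {relT, relS} := by
  ext R
  simp [Program.idb, mem_rules_allBlackProgram, edgeRule, eq_comm (a := R)]

theorem exists_eq_unaryAtom_of_mem_atoms {r : Rule D} (hr : r ∈ (allBlackProgram D).rules)
    {A : Atom D} (hA : A ∈ r.atoms) :
    ∃ R ∈ ({relR, relB, relT, relS} : Set RelName), ∃ e, A = unaryAtom R e := by
  rcases mem_rules_allBlackProgram.1 hr with rfl | rfl <;>
    rcases mem_atoms_edgeRule.1 hA with rfl | rfl | rfl <;> exact ⟨_, by simp, _, rfl⟩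

theorem relNames_allBlackProgram_subset :
    (allBlackProgram D).relNames ⊆ {relR, relB, relT, relS} := by
  rintro R ⟨r, hr, args, hA⟩
  obtain ⟨R', hR', e, h⟩ := exists_eq_unaryAtom_of_mem_atoms hr hA
  cases h
  exact hR'

theorem eq_of_dependsOn_allBlackProgram {R₁ R₂ : RelName}
    (h : (allBlackProgram D).DependsOn R₁ R₂) : R₁ = relS ∧ R₂ = relT := by
  obtain ⟨-, hR₂, r, hr, rfl, L, hL, args, hA⟩ := h
  rw [idb_allBlackProgram] at hR₂
  rcases mem_rules_allBlackProgram.1 hr with rfl | rfl <;>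
    rcases mem_body_edgeRule.1 hL with rfl | rfl <;> cases hA
  · exact absurd hR₂ (by simp [relR, relT, relS])
  · exact absurd hR₂ (by simp [relB, relT, relS])
  · exact absurd hR₂ (by simp [relR, relT, relS])
  · exact ⟨rfl, rfl⟩

theorem inFragment_allBlackProgram :
    (allBlackProgram D).InFragment {.intermediate, .negation} := by
  rintro (_ | _ | _ | _ | _ | _) hX
  case arity =>
    obtain ⟨R, hR, hlt⟩ := hX
    rcases relNames_allBlackProgram_subset hR with rfl | rfl | rfl | rfl <;>
      exact absurd hlt (by decide)
  case recursion =>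
    obtain ⟨R, hR⟩ := hX
    obtain ⟨_, hhead, -⟩ := Relation.TransGen.head'_iff.1 hR
    obtain ⟨_, -, htail⟩ := Relation.TransGen.tail'_iff.1 hR
    have hST : relS = relT :=
      (eq_of_dependsOn_allBlackProgram hhead).1.symm.trans (eq_of_dependsOn_allBlackProgram htail).2
    exact absurd hST (by decide)
  case equations =>
    obtain ⟨r, hr, L, hL, e₁, e₂, hA⟩ := hX
    obtain ⟨R, -, e, h⟩ := exists_eq_unaryAtom_of_mem_atoms hr (Or.inr ⟨L, hL, hA⟩)
    cases h
  case packing =>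
    obtain ⟨r, hr, e, he, e', ht⟩ := hX
    rcases mem_rules_allBlackProgram.1 hr with rfl | rfl <;>
      obtain ⟨j, h⟩ := eq_atomicVar_of_mem_exprs_edgeRule he ht <;> cases h
  all_goals simp

theorem isOver_allBlackProgram : (allBlackProgram D).IsOver {relR, relB} := by
  rw [Program.IsOver, Program.edb, idb_allBlackProgram]
  constructor
  · rintro R ⟨hR, hidb⟩
    rcases relNames_allBlackProgram_subset hR with rfl | rfl | hR
    · decide
    · decide
    · exact absurd hR hidb
  · rintro R (rfl | rfl) <;> decide

/-- The result of the first stratum of `allBlackProgram`, which adds the nodes with an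
out-neighbour that is not black. -/
def firstStratumResult (J : Set (Fact D)) : Set (Fact D) :=
  J ∪ immediateConsequences {edgeRule D relT relB 1} J

theorem isResult_allBlackProgram {J : Set (Fact D)} (hJ : J.Finite) :
    (allBlackProgram D).IsResult J (firstStratumResult J ∪
      immediateConsequences {edgeRule D relS relT 0} (firstStratumResult J)) := by
  have hT : (immediateConsequences {edgeRule D relT relB 1} J).Finite :=
    finite_immediateConsequences_edgeRule hJ
  have hM : (firstStratumResult J).Finite := hJ.union hT
  exact ⟨_, (isNonrecursive_edgeRule (by decide) (by decide)).isStratumResult hJ hT, _,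
    (isNonrecursive_edgeRule (by decide) (by decide)).isStratumResult hM
      (finite_immediateConsequences_edgeRule hM), rfl⟩

theorem mem_firstStratumResult_iff {J : Set (Fact D)} {f : Fact D} (hf : f.rel ≠ relT) :
    f ∈ firstStratumResult J ↔ f ∈ J :=
  mem_union_immediateConsequences_iff fun _ hr => Finset.mem_singleton.1 hr ▸ hf.symm

theorem nodeFact_relT_mem_firstStratumResult {J : Set (Fact D)} (hJ : ∀ f ∈ J, f.rel ≠ relT)
    {x : D} : nodeFact relT x ∈ firstStratumResult J ↔
      ∃ y, edgeFact x y ∈ J ∧ blackFact y ∉ J := by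
  constructor
  · rintro (h | h)
    · exact absurd rfl (hJ _ h)
    · obtain ⟨x', y, hR, hB, heq⟩ := mem_immediateConsequences_edgeRule.1 h
      obtain rfl := (nodeFact_inj Nat.one_pos).1 heq
      exact ⟨y, hR, hB⟩
  · rintro ⟨y, hR, hB⟩
    exact Or.inr (mem_immediateConsequences_edgeRule.2 ⟨x, y, hR, hB, rfl⟩)

theorem mem_immediateConsequences_firstStratumResult {J : Set (Fact D)}
    (hJ : ∀ f ∈ J, f.rel ≠ relT) {f : Fact D} :
    f ∈ immediateConsequences {edgeRule D relS relT 0} (firstStratumResult J) ↔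
      ∃ x, f = outFact x ∧ (∃ y, edgeFact x y ∈ J) ∧ ∀ y, edgeFact x y ∈ J → blackFact y ∈ J := by
  have hedge (x y : D) : edgeFact x y ∈ firstStratumResult J ↔ edgeFact x y ∈ J :=
    mem_firstStratumResult_iff (by change relR ≠ relT; decide)
  have hT (x : D) : nodeFact relT x ∉ firstStratumResult J ↔
      ∀ y, edgeFact x y ∈ J → blackFact y ∈ J := by
    rw [nodeFact_relT_mem_firstStratumResult hJ]
    push Not
    rfl
  rw [mem_immediateConsequences_edgeRule]
  constructor
  · rintro ⟨x, y, hR, hTx, rfl⟩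
    exact ⟨x, rfl, ⟨y, (hedge x y).1 hR⟩, (hT x).1 hTx⟩
  · rintro ⟨x, rfl, ⟨y, hR⟩, hall⟩
    exact ⟨x, y, (hedge x y).2 hR, (hT x).2 hall, rfl⟩

theorem computes_allBlackProgram : (allBlackProgram D).Computes (allBlackQuery D) := by
  refine ⟨isOver_allBlackProgram, fun I => ⟨_, isResult_allBlackProgram I.finite⟩,
    by simp [idb_allBlackProgram], fun I K hK => ?_⟩
  obtain rfl := IsStrataResult.unique hK (isResult_allBlackProgram I.finite)
  have hI (R : RelName) (hR : R ∉ ({relR, relB} : Schema)) : ∀ f ∈ I.facts, f.rel ≠ R := by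
    rintro f hf rfl
    exact hR (I.rel_mem f hf)
  ext f
  refine Iff.trans ?_ (mem_immediateConsequences_firstStratumResult (hI relT (by decide)))
  constructor
  · rintro ⟨hf | hf, hS⟩
    · rw [mem_firstStratumResult_iff (by rw [hS]; decide)] at hf
      exact absurd hS (hI relS (by decide) f hf)
    · exact hf
  · intro hf
    refine ⟨Or.inr hf, ?_⟩
    obtain ⟨x, y, -, -, rfl⟩ := mem_immediateConsequences_edgeRule.1 hf
    rfl

theorem computableIn_allBlackQuery :
    Query.ComputableIn (allBlackQuery D) {.intermediate, .negation} :=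
  ⟨allBlackProgram D, inFragment_allBlackProgram, computes_allBlackProgram⟩

theorem isMonadic_relR_relB : Schema.IsMonadic {relR, relB} := by
  unfold Schema.IsMonadic
  decide

end SeqDatalog

theorem mainTheorem7_general (D : Type*) [Infinite D] :
    SeqDatalog.Query.ComputableIn (SeqDatalog.allBlackQuery D) {.intermediate, .negation} ∧
    ¬ SeqDatalog.Query.ComputableIn (SeqDatalog.allBlackQuery D) (Set.univ \ {.intermediate}) ∧
    SeqDatalog.PrimitiveInPresence D .intermediate {.negation} :=
  ⟨SeqDatalog.computableIn_allBlackQuery, SeqDatalog.not_computableIn_allBlackQuery,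
    SeqDatalog.primitiveInPresence_of_computableIn SeqDatalog.isMonadic_relR_relB (by decide) le_rfl
      SeqDatalog.computableIn_allBlackQuery SeqDatalog.not_computableIn_allBlackQuery⟩

theorem mainTheorem7 (D : Type*) [Countable D] [Infinite D] :
    SeqDatalog.Query.ComputableIn (SeqDatalog.allBlackQuery D) {.intermediate, .negation} ∧
    ¬ SeqDatalog.Query.ComputableIn (SeqDatalog.allBlackQuery D) (Set.univ \ {.intermediate}) ∧
    SeqDatalog.PrimitiveInPresence D .intermediate {.negation} :=
  mainTheorem7_general D
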